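/- Identify $\mathbb C^n$ with $\mathbb R^{2n}$ with the Euclidean inner product $\langle\cdot,\cdot\rangle$; let $J$ be multiplication by $\sqrt{-1}$, $\mathscr H^k$ the $k$-dimensional Hausdorff measure and $B_\varepsilon(x)$ the open ball. An integral rectifiable $n$-varifold $(S,\beta)$ in an open set $U$ is an $\mathscr H^n$-measurable, countably $n$-rectifiable set $S\subseteq U$ with an $\mathbb N$-valued multiplicity $\beta$ that is locally $\mathscr H^n$-integrable on $S$; its measure is $\mu_S=\mathscr H^n\llcorner\beta$. A locally $\mu_S$-integrable vector field $H$ is a generalized mean curvature of $(S,\beta)$ in $U$ if $\int \operatorname{div}_S X\,d\mu_S=-\int\langle H,X\rangle\,d\mu_S$ for all $C^1$ vector fields $X$ with compact support in $U$, where $\operatorname{div}_S$ is the divergence along the approximate tangent spaces. With such an $H$, $(S,\beta)$ is Hamiltonian stationary in $U$ if $\int\langle J Df,H\rangle\,d\mu_S=0$ for all $f\in C_c^\infty(U)$. **Theorem.** Let $\Omega\subseteq\mathbb C^n$ be open and let $N=\bigcup_{\alpha=1}^{\alpha_0}N_\alpha$ be a finite union of compact sets $N_\alpha\subset\Omega$.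 Suppose that for each $\alpha$ there is a real number $0\le k_\alpha\le n-2$ such that $\mathscr H^{k_\alpha}(N_\alpha)<\infty$ and $N_\alpha$ is locally $k_\alpha$-noncollapsing: there are $\delta>0$ and $C_3>0$ with $\mathscr H^{k_\alpha}(N_\alpha\cap B_\varepsilon(x))\ge C_3\,\varepsilon^{k_\alpha}$ for all $x\in N_\alpha$ and all $\varepsilon\in(0,\delta)$. Let $L\subseteq\Omega\setminus N$ be an immersed Lagrangian submanifold (the image of a smooth Lagrangian immersion of an $n$-manifold) such that $(\overline L\cap\Omega)\setminus L\subseteq N$. Let $\beta$ be an $\mathbb N$-valued $\mathscr H^n$-integrable function on $L$ and $\mu_L=\mathscr H^n\llcorner\beta$, and suppose that $(L,\beta)$ is Hamiltonian stationary in $\Omega\setminus N$ with generalized mean curvature $H$. Assume: (i) $\int_\Omega|H|^n\,d\mu_L<C_1$ for a constant $C_1$; (ii) there is a constant $C_4>0$ such that $\mu_L(E)\le C_4\,\mathscr H^n(E)$ for every relatively open set $E\subseteq L$; (iii) there are a constant $C_2$ and a decreasing sequence $\varepsilon_i\to0$ of positive numbers such that $\mathscr H^n(L\cap B_{\varepsilon_i}(y))<C_2\,\varepsilon_i^{\,k_\alpha+\frac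 n{n-1}}$ for all $i$, all $\alpha$ and all $y\in N_\alpha$. Then $\overline L\cap\Omega$, the closure of $L$ in $\Omega$, with the multiplicity $\beta$ (extended arbitrarily to $\overline L\cap\Omega\setminus L$, which is $\mathscr H^n$-null), is an integral rectifiable $n$-varifold in $\Omega$, it admits a generalized mean curvature $\mathcal H$ in $\Omega$, and it is Hamiltonian stationary in $\Omega$: $$\int_\Omega\langle J Df,\mathcal H\rangle\,d\mu_{\overline L}=0\qquad\text{for all } f\in C_c^\infty(\Omega).$$ -/

import Mathlib

open MeasureTheory Filter Topology Set
open scoped ContDiff Manifold ENNReal InnerProductSpace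

/-- `ℂⁿ` with its Euclidean metric; the real inner product is `⟪x, y⟫_ℝ = Re ∑ conj (x i) * y i`. -/
abbrev ComplexSpace (n : ℕ) : Type := EuclideanSpace ℂ (Fin n)

namespace HamStat

/-- The standard complex structure of `ℂⁿ`: multiplication by the imaginary unit. -/
noncomputable def J {n : ℕ} (v : ComplexSpace n) : ComplexSpace n := Complex.I • v

/-- The standard symplectic form `ω(v, w) = ⟨J v, w⟩` of `ℂⁿ`. -/
noncomputable def symplecticForm {n : ℕ} (v w : ComplexSpace n) : ℝ := ⟪J v, w⟫_ℝ

/-- A smooth Lagrangian immersion of an `n`-manifold into `ℂⁿ`: the differential is injective at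
every point and the symplectic form vanishes on its range, which has dimension `n`. -/
structure IsLagrangianImmersion {n : ℕ} {M : Type*} [TopologicalSpace M]
    [ChartedSpace (EuclideanSpace ℝ (Fin n)) M] (F : M → ComplexSpace n) : Prop where
  smooth : ContMDiff (𝓡 n) 𝓘(ℝ, ComplexSpace n) ∞ F
  immersion : ∀ p : M, Function.Injective (mfderiv (𝓡 n) 𝓘(ℝ, ComplexSpace n) F p)
  lagrangian : ∀ (p : M) (v w : TangentSpace (𝓡 n) p),
    symplecticForm (n := n) (mfderiv (𝓡 n) 𝓘(ℝ, ComplexSpace n) F p v)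
      (mfderiv (𝓡 n) 𝓘(ℝ, ComplexSpace n) F p w) = 0

/-- The local `k`-noncollapsing property of a set `A`:
`inf_{x ∈ A} ℋᵏ(A ∩ B_ε(x)) ≥ C εᵏ` for all small `ε`.
Here and below `μH[k]` is the Hausdorff measure of Mathlib, which is the usual one up to a positive
factor that depends on `k` only. -/
def LocallyNoncollapsing {n : ℕ} (k : ℝ) (A : Set (ComplexSpace n)) : Prop :=
  ∃ δ : ℝ, 0 < δ ∧ ∃ C : ℝ, 0 < C ∧ ∀ ε ∈ Ioo 0 δ, ∀ x ∈ A,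
    ENNReal.ofReal (C * ε ^ k) ≤ μH[k] (A ∩ Metric.ball x ε)

/-- The weight measure `ℋᵏ ⌞ β` of the pair `(S, β)`. -/
noncomputable def weight {n : ℕ} (k : ℕ) (S : Set (ComplexSpace n)) (β : ComplexSpace n → ℕ) :
    Measure (ComplexSpace n) :=
  ((μH[(k : ℝ)] : Measure (ComplexSpace n)).restrict S).withDensity fun x => (β x : ℝ≥0∞)

/-- `(S, β)` is an integral rectifiable `k`-varifold in the open set `U`: `S ⊆ U` is
`ℋᵏ`-measurable and countably `k`-rectifiable, and the `ℕ`-valued multiplicity `β` is locally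
`ℋᵏ`-integrable on `S`. The values of `β` outside `S` play no role. -/
structure IsIntegralVarifold {n : ℕ} (k : ℕ) (U S : Set (ComplexSpace n))
    (β : ComplexSpace n → ℕ) : Prop where
  subset : S ⊆ U
  measurable : NullMeasurableSet S (μH[(k : ℝ)] : Measure (ComplexSpace n))
  rectifiable : ∃ F : ℕ → EuclideanSpace ℝ (Fin k) → ComplexSpace n,
    (∀ j, ∃ K, LipschitzWith K (F j)) ∧ μH[(k : ℝ)] (S \ ⋃ j, range (F j)) = 0
  multiplicity : LocallyIntegrableOn (fun x => (β x : ℝ)) U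
    ((μH[(k : ℝ)] : Measure (ComplexSpace n)).restrict S)

/-- `P` is the approximate `k`-dimensional tangent space of the measure `μ` at `x`: the rescaled
measures `r⁻ᵏ (z ↦ (z - x) / r)_* μ` converge, as `r ↓ 0`, to a positive multiple of `ℋᵏ ⌞ P`,
tested against continuous functions with compact support. -/
def IsApproxTangent {n : ℕ} (k : ℕ) (μ : Measure (ComplexSpace n)) (x : ComplexSpace n)
    (P : Submodule ℝ (ComplexSpace n)) : Prop :=
  Module.finrank ℝ P = k ∧ ∃ θ : ℝ, 0 < θ ∧
    ∀ φ : ComplexSpace n → ℝ, Continuous φ → HasCompactSupport φ →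
      Tendsto (fun r : ℝ => (r ^ k)⁻¹ * ∫ z, φ (r⁻¹ • (z - x)) ∂μ) (𝓝[>] 0)
        (𝓝 (θ * ∫ z in (P : Set (ComplexSpace n)), φ z ∂μH[(k : ℝ)]))

open Classical in
/-- The approximate tangent space of `μ` at `x`. For a rectifiable `k`-varifold it exists at almost
every point; where there is none the value is `⊥`. -/
noncomputable def approxTangent {n : ℕ} (k : ℕ) (μ : Measure (ComplexSpace n))
    (x : ComplexSpace n) : Submodule ℝ (ComplexSpace n) :=
  if h : ∃ P, IsApproxTangent k μ x P then h.choose else ⊥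

/-- The divergence `∑ ⟨D_{e_i} X, e_i⟩` of a vector field at `x` along the subspace `P`, for an
orthonormal basis `e_i` of `P`. -/
noncomputable def divAlong {n : ℕ} (P : Submodule ℝ (ComplexSpace n))
    (X : ComplexSpace n → ComplexSpace n) (x : ComplexSpace n) : ℝ :=
  ∑ i, ⟪fderiv ℝ X x (stdOrthonormalBasis ℝ P i), (stdOrthonormalBasis ℝ P i : ComplexSpace n)⟫_ℝ

/-- `H` is the generalized mean curvature in `U` of the `k`-varifold with weight measure `μ`:
`H` is locally `μ`-integrable and `∫ div X dμ = - ∫ ⟨H, X⟩ dμ` for every `C¹` vector field `X` with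
compact support in `U`, the divergence being taken along the approximate tangent spaces. -/
structure HasGeneralizedMeanCurvature {n : ℕ} (k : ℕ) (U : Set (ComplexSpace n))
    (μ : Measure (ComplexSpace n)) (H : ComplexSpace n → ComplexSpace n) : Prop where
  locallyIntegrable : LocallyIntegrableOn H U μ
  firstVariation : ∀ X : ComplexSpace n → ComplexSpace n,
    ContDiff ℝ 1 X → HasCompactSupport X → tsupport X ⊆ U →
      Integrable (fun x => divAlong (approxTangent k μ x) X x) μ ∧
      ∫ x, divAlong (approxTangent k μ x) X x ∂μ = - ∫ x, ⟪H x, X x⟫_ℝ ∂μ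

/-- `(S, β)` is an integral rectifiable `k`-varifold in `U` with generalized mean curvature `H`, and
it is Hamiltonian stationary in `U`: `∫ ⟨J Df, H⟩ dμ = 0` for all `f ∈ C_c^∞(U)`. -/
structure IsHamiltonianStationary {n : ℕ} (k : ℕ) (U S : Set (ComplexSpace n))
    (β : ComplexSpace n → ℕ) (H : ComplexSpace n → ComplexSpace n) : Prop where
  varifold : IsIntegralVarifold k U S β
  meanCurvature : HasGeneralizedMeanCurvature k U (weight k S β) H
  stationary : ∀ f : ComplexSpace n → ℝ,
    ContDiff ℝ ∞ f → HasCompactSupport f → tsupport f ⊆ U →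
      ∫ x, ⟪J (gradient f x), H x⟫_ℝ ∂(weight k S β) = 0

end HamStat

/-! The set `N` is removable by a cutoff argument, and the mean curvature on `Ω` is the given `H`.
Noncollapsing and finite `ℋ^k` mass cover each piece of `N` by `O(ε^(-k))` balls of radius `ε`.
Assumptions (ii) and (iii) bound the mass of each ball, so the `ε / 2`-neighbourhood of `N` has mass
`O(ε^p)` with `p = n / (n - 1)` (`exists_measure_thickening_iUnion_le`).

Test fields and functions on `Ω` are multiplied by cutoffs vanishing near `N`, with gradient `O(1 /
ε)`. The divergence error is `O(ε^(p - 1))`, which tends to `0`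
(`hasGeneralizedMeanCurvature_of_removable`). The stationarity error is at most a constant times
`ε⁻¹ ∫ |H|` over the neighbourhood. Hölder bounds this by the `L^n` norm of `H` there times `ε⁻¹
(ε^p)^(1 / p) = 1`, and that norm tends to `0` by absolute continuity of the integral
(`integral_inner_gradient_eq_zero_of_removable`). The exponent `p`, conjugate to `n`, is thus
critical for the second error. Passing from `L` to its closure adds only a null set. -/

namespace HamStat

/-! ### Packing: mass of neighbourhoods of a noncollapsing set. -/

section Packing

variable {X : Type*} [MetricSpace X] [MeasurableSpace X] [BorelSpace X]

/-- A compact set all of whose `r`-balls have mass at least `c` is covered, together with its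
`2r`-thickening, by at most `ν A / c` balls of radius `4r`. -/
theorem exists_finset_cover_thickening {A : Set X} (hA : IsCompact A) (ν : Measure X) {r : ℝ}
    (hr : 0 < r) {c : ℝ≥0∞} (hc : ∀ x ∈ A, c ≤ ν (A ∩ Metric.ball x r)) :
    ∃ t : Finset X, (t : Set X) ⊆ A ∧ t.card * c ≤ ν A ∧
      Metric.thickening (2 * r) A ⊆ ⋃ y ∈ t, Metric.ball y (4 * r) := by
  lift r to NNReal using hr.le
  have hr0 : r ≠ 0 := by rintro rfl; simp at hr
  obtain ⟨s, -, hsfin, hs⟩ := Metric.exists_finite_isCover_of_isCompact hr0 hA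
  have hpack : Metric.packingNumber (2 * r) A ≠ ⊤ := by
    refine ne_top_of_le_ne_top ?_ (Metric.packingNumber_two_mul_le_externalCoveringNumber r A)
    exact ne_top_of_le_ne_top hsfin.encard_lt_top.ne hs.externalCoveringNumber_le_encard
  -- Separation `2r` makes the `r`-balls disjoint, which bounds the cardinality; maximality makes
  -- `S` a `2r`-net, so the `2r`-thickening lies in `4r`-balls.
  set S := Metric.maximalSeparatedSet (2 * r) A with hS
  have hSfin : S.Finite := by
    rw [← Set.encard_ne_top_iff, hS, Metric.encard_maximalSeparatedSet hpack]
    exact hpack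
  have hSA : S ⊆ A := Metric.maximalSeparatedSet_subset
  have hcov := Metric.isCover_iff_subset_iUnion_closedBall.1
    (Metric.isCover_maximalSeparatedSet hpack)
  have hsep : Metric.IsSeparated _ S := Metric.isSeparated_maximalSeparatedSet
  refine ⟨hSfin.toFinset, by simpa using hSA, ?_, ?_⟩
  · calc (hSfin.toFinset.card : ℝ≥0∞) * c = ∑ y ∈ hSfin.toFinset, c := by simp
      _ ≤ ∑ y ∈ hSfin.toFinset, ν (A ∩ Metric.ball y r) :=
        Finset.sum_le_sum fun y hy => hc y (hSA (by simpa using hy))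
      _ = ν (⋃ y ∈ hSfin.toFinset, A ∩ Metric.ball y r) := by
        refine (measure_biUnion_finset ?_ fun y _ => hA.measurableSet.inter measurableSet_ball).symm
        intro x hx y hy hxy
        refine Disjoint.mono inter_subset_right inter_subset_right (Metric.ball_disjoint_ball ?_)
        have h := hsep (by simpa using hx) (by simpa using hy) hxy
        have h2 : ((2 * r : NNReal) : ℝ≥0∞) < edist x y := h
        rw [edist_nndist, ENNReal.coe_lt_coe] at h2
        have h3 : ((2 * r : NNReal) : ℝ) < nndist x y := by exact_mod_cast h2
        rw [coe_nndist] at h3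
        push_cast at h3
        linarith
      _ ≤ ν A := measure_mono (iUnion₂_subset fun _ _ => inter_subset_left)
  · intro x hx
    obtain ⟨z, hz, hxz⟩ := Metric.mem_thickening_iff.1 hx
    obtain ⟨y, hy, hzy⟩ := mem_iUnion₂.1 (hcov hz)
    refine mem_iUnion₂.2 ⟨y, by simpa using hy, ?_⟩
    have h1 : dist z y ≤ 2 * (r : ℝ) := by simpa using hzy
    have := dist_triangle x z y
    rw [Metric.mem_ball]
    linarith

/-- If `A` is noncollapsing of dimension `k` with finite `ν`-mass, and balls of radius `ε` centred
on `A` have `μ`-mass at most `C' ε ^ (k + p)`, then the `ε / 2`-thickening of `A` has `μ`-mass of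
order `ε ^ p`. -/
theorem exists_measure_thickening_le {A : Set X} (hA : IsCompact A) (ν μ : Measure X)
    (hνA : ν A < ⊤) {k p C C' : ℝ} (hC : 0 < C) (hC' : 0 ≤ C') :
    ∃ K : ℝ, 0 ≤ K ∧ ∀ ε : ℝ, 0 < ε →
      (∀ x ∈ A, ENNReal.ofReal (C * (ε / 4) ^ k) ≤ ν (A ∩ Metric.ball x (ε / 4))) →
      (∀ y ∈ A, μ (Metric.ball y ε) ≤ ENNReal.ofReal (C' * ε ^ (k + p))) →
      μ (Metric.thickening (ε / 2) A) ≤ ENNReal.ofReal (K * ε ^ p) := by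
  refine ⟨(ν A).toReal * (4 ^ k / C) * C', by positivity, fun ε hε h1 h2 => ?_⟩
  obtain ⟨t, htA, htc, hcov⟩ := exists_finset_cover_thickening hA ν (r := ε / 4) (by positivity) h1
  rw [show 2 * (ε / 4) = ε / 2 by ring, show 4 * (ε / 4) = ε by ring] at hcov
  have hcard : (t.card : ℝ) * (C * (ε / 4) ^ k) ≤ (ν A).toReal := by
    have := ENNReal.toReal_mono hνA.ne htc
    rwa [ENNReal.toReal_mul, ENNReal.toReal_ofReal (by positivity), ENNReal.toReal_natCast] at this
  have hεk : 0 < ε ^ k := Real.rpow_pos_of_pos hε k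
  have h4k : (0 : ℝ) < 4 ^ k := by positivity
  have hcard' : (t.card : ℝ) * ε ^ k ≤ (ν A).toReal * (4 ^ k / C) := by
    rw [Real.div_rpow hε.le (by norm_num)] at hcard
    calc (t.card : ℝ) * ε ^ k = (t.card * (C * (ε ^ k / 4 ^ k))) * (4 ^ k / C) := by
          field_simp
      _ ≤ _ := by gcongr
  calc μ (Metric.thickening (ε / 2) A) ≤ μ (⋃ y ∈ t, Metric.ball y ε) := measure_mono hcov
    _ ≤ ∑ y ∈ t, μ (Metric.ball y ε) := measure_biUnion_finset_le _ _
    _ ≤ ∑ y ∈ t, ENNReal.ofReal (C' * ε ^ (k + p)) := Finset.sum_le_sum fun y hy => h2 y (htA hy)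
    _ = ENNReal.ofReal (t.card * (C' * ε ^ (k + p))) := by
      rw [Finset.sum_const, nsmul_eq_mul, ENNReal.ofReal_mul (Nat.cast_nonneg t.card),
        ENNReal.ofReal_natCast]
    _ ≤ ENNReal.ofReal ((ν A).toReal * (4 ^ k / C) * C' * ε ^ p) := by
      refine ENNReal.ofReal_le_ofReal ?_
      rw [Real.rpow_add hε]
      calc (t.card : ℝ) * (C' * (ε ^ k * ε ^ p)) = (t.card * ε ^ k) * (C' * ε ^ p) := by ring
        _ ≤ ((ν A).toReal * (4 ^ k / C)) * (C' * ε ^ p) := by gcongr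
        _ = _ := by ring

end Packing

/-! ### Smooth cutoffs near a set. -/

section Cutoff

variable {E : Type*} [NormedAddCommGroup E] [InnerProductSpace ℝ E] [FiniteDimensional ℝ E]

/-- Smooth cutoff functions at scale `r` around a set, with gradient at most `4 / r`. -/
theorem exists_smooth_cutoff (A : Set E) {r : ℝ} (hr : 0 < r) :
    ∃ χ : E → ℝ, ContDiff ℝ ∞ χ ∧ (∀ x, χ x ∈ Icc (0 : ℝ) 1) ∧ (∀ x, ‖fderiv ℝ χ x‖ ≤ 4 / r) ∧
      (∀ x, Metric.infDist x A < r / 4 → χ x = 0) ∧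
      ∀ x, 3 * r / 4 ≤ Metric.infDist x A → χ x = 1 := by
  borelize E
  let μ : Measure E := Measure.addHaar
  -- `g` is `0` up to distance `3r / 8` and `1` from `5r / 8` on. Mollifying at radius `r / 8`
  -- leaves the plateaus up to `r / 4` and from `3r / 4` on.
  let φ : ContDiffBump (0 : E) := ⟨r / 16, r / 8, by positivity, by linarith⟩
  let g : E → ℝ := fun x => max 0 (min 1 (4 / r * Metric.infDist x A - 3 / 2))
  have hglip : LipschitzWith (Real.toNNReal (4 / r)) g := by
    refine LipschitzWith.of_dist_le_mul fun x y => ?_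
    rw [Real.coe_toNNReal _ (by positivity), Real.dist_eq]
    calc |g x - g y| ≤ |min 1 (4 / r * Metric.infDist x A - 3 / 2)
            - min 1 (4 / r * Metric.infDist y A - 3 / 2)| := by
          simpa using abs_max_sub_max_le_max 0 (min 1 (4 / r * Metric.infDist x A - 3 / 2)) 0
            (min 1 (4 / r * Metric.infDist y A - 3 / 2))
      _ ≤ |(4 / r * Metric.infDist x A - 3 / 2) - (4 / r * Metric.infDist y A - 3 / 2)| := by
          simpa using abs_min_sub_min_le_max 1 (4 / r * Metric.infDist x A - 3 / 2) 1
            (4 / r * Metric.infDist y A - 3 / 2)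
      _ = 4 / r * |Metric.infDist x A - Metric.infDist y A| := by
          rw [show (4 / r * Metric.infDist x A - 3 / 2) - (4 / r * Metric.infDist y A - 3 / 2)
            = 4 / r * (Metric.infDist x A - Metric.infDist y A) by ring, abs_mul,
            abs_of_pos (by positivity)]
      _ ≤ 4 / r * dist x y := by
          gcongr
          have := (Metric.lipschitz_infDist_pt A).dist_le_mul x y
          simpa [Real.dist_eq] using this
  have hgc : Continuous g := hglip.continuous
  have hg0 : ∀ x, 0 ≤ g x := fun x => le_max_left _ _
  have hg1 : ∀ x, g x ≤ 1 := fun x => max_le zero_le_one (min_le_left _ _)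
  have hφc : Continuous (φ.normed μ) := (φ.contDiff_normed (μ := μ) (n := 0)).continuous
  have hint : ∀ x, Integrable (fun t => φ.normed μ t * g (x - t)) μ := fun x =>
    (hφc.mul (hgc.comp (continuous_const.sub continuous_id))).integrable_of_hasCompactSupport
      (φ.hasCompactSupport_normed (μ := μ)).mul_right
  let χ : E → ℝ := fun x => ∫ t, φ.normed μ t * g (x - t) ∂μ
  have hχ : χ = (convolution (φ.normed μ) g (ContinuousLinearMap.lsmul ℝ ℝ) μ) := by
    ext x; simp [χ, convolution_def]
  have hconst : ∀ x, (∀ y ∈ Metric.ball x (r / 8), g y = g x) → χ x = g x := fun x hx => by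
    rw [hχ]; exact φ.normed_convolution_eq_right hx
  -- Averaging against a probability density keeps the Lipschitz constant of `g`.
  have hχlip : LipschitzWith (Real.toNNReal (4 / r)) χ := by
    refine LipschitzWith.of_dist_le_mul fun x y => ?_
    rw [dist_eq_norm, ← integral_sub (hint x) (hint y)]
    calc ‖∫ t, (φ.normed μ t * g (x - t) - φ.normed μ t * g (y - t)) ∂μ‖
        ≤ ∫ t, φ.normed μ t * ((Real.toNNReal (4 / r)) * dist x y) ∂μ := by
          refine norm_integral_le_of_norm_le ((φ.integrable_normed (μ := μ)).mul_const _)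
            (Eventually.of_forall fun t => ?_)
          rw [← mul_sub, norm_mul, Real.norm_of_nonneg (φ.nonneg_normed t)]
          gcongr
          · exact φ.nonneg_normed t
          · simpa [Real.dist_eq] using hglip.dist_le_mul (x - t) (y - t)
      _ = (Real.toNNReal (4 / r)) * dist x y := by
          rw [integral_mul_const, φ.integral_normed, one_mul]
  have hinf : ∀ x y, y ∈ Metric.ball x (r / 8) →
      |Metric.infDist y A - Metric.infDist x A| < r / 8 := fun x y hy => by
    have := (Metric.lipschitz_infDist_pt A).dist_le_mul y x
    rw [Real.dist_eq] at this
    simp only [NNReal.coe_one, one_mul] at this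
    exact this.trans_lt hy
  refine ⟨χ, ?_, fun x => ⟨?_, ?_⟩, fun x => ?_, fun x hx => ?_, fun x hx => ?_⟩
  · rw [hχ]
    exact φ.hasCompactSupport_normed.contDiff_convolution_left _ φ.contDiff_normed
      hgc.locallyIntegrable
  · exact integral_nonneg fun t => mul_nonneg (φ.nonneg_normed t) (hg0 _)
  · calc χ x ≤ ∫ t, φ.normed μ t ∂μ := integral_mono (hint x) φ.integrable_normed fun t =>
          mul_le_of_le_one_right (φ.nonneg_normed t) (hg1 _)
      _ = 1 := φ.integral_normed
  · simpa [Real.coe_toNNReal _ (show 0 ≤ 4 / r by positivity)] using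
      norm_fderiv_le_of_lipschitz ℝ hχlip (x₀ := x)
  · have key : ∀ y, Metric.infDist y A < 3 * r / 8 → g y = 0 := fun y hy => by
      refine max_eq_left ((min_le_right _ _).trans ?_)
      have : 4 / r * Metric.infDist y A ≤ 4 / r * (3 * r / 8) := by gcongr
      have h2 : 4 / r * (3 * r / 8) = 3 / 2 := by field_simp; norm_num
      linarith
    have hx0 := key x (by linarith)
    rw [hconst x fun y hy => ?_, hx0]
    rw [hx0, key y]
    linarith [(abs_lt.1 (hinf x y hy)).2]
  · have key : ∀ y, 5 * r / 8 ≤ Metric.infDist y A → g y = 1 := fun y hy => by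
      have : 4 / r * (5 * r / 8) ≤ 4 / r * Metric.infDist y A := by gcongr
      have h2 : 4 / r * (5 * r / 8) = 5 / 2 := by field_simp; norm_num
      simp only [g]
      rw [min_eq_left (by linarith), max_eq_right zero_le_one]
    have hx0 := key x (by linarith)
    rw [hconst x fun y hy => ?_, hx0]
    rw [hx0, key y]
    linarith [(abs_lt.1 (hinf x y hy)).1]

/-- A compactly supported `C^m` map can be cut off near a nonempty set `A` at any scale `r ≤ 1`, at
the cost of an error in the derivative of order `1 / r`, supported in the `r`-thickening of `A`. -/
theorem exists_cutoff_map {F : Type*} [NormedAddCommGroup F] [NormedSpace ℝ F] {A : Set E}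
    (hA : A.Nonempty) {m : WithTop ℕ∞} (hm1 : 1 ≤ m) (hm : m ≤ (∞ : ℕ∞ω)) {X : E → F} (hX : ContDiff ℝ m X)
    (hXc : HasCompactSupport X) :
    ∃ K : ℝ, 0 ≤ K ∧ ∀ r : ℝ, 0 < r → r ≤ 1 → ∃ Y : E → F, ContDiff ℝ m Y ∧ HasCompactSupport Y ∧
      tsupport Y ⊆ tsupport X \ A ∧ (∀ x, ‖Y x‖ ≤ ‖X x‖) ∧
      (∀ x, x ∉ Metric.thickening r A → Y x = X x ∧ fderiv ℝ Y x = fderiv ℝ X x) ∧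
      ∀ x, ‖fderiv ℝ X x - fderiv ℝ Y x‖ ≤ K / r := by
  obtain ⟨B, hB⟩ := hXc.exists_bound_of_continuous hX.continuous
  obtain ⟨B', hB'⟩ := (hXc.fderiv (𝕜 := ℝ)).exists_bound_of_continuous
    (hX.continuous_fderiv (by positivity))
  have hB0 : 0 ≤ B := (norm_nonneg _).trans (hB 0)
  have hB0' : 0 ≤ B' := (norm_nonneg _).trans (hB' 0)
  -- In the product rule, `(1 - χ) DX` costs `B' ≤ B' / r` because `r ≤ 1`, and `Dχ ⊗ X` costs `4B /
  -- r`.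
  refine ⟨B' + 4 * B, by positivity, fun r hr hr1 => ?_⟩
  obtain ⟨χ, hχ, hχ01, hχd, hχ0, hχ1⟩ := exists_smooth_cutoff A hr
  have hdX : Differentiable ℝ X := hX.differentiable (by positivity)
  have hdχ : Differentiable ℝ χ := hχ.differentiable (by simp)
  have hfd : ∀ x, fderiv ℝ (fun x => χ x • X x) x = χ x • fderiv ℝ X x
      + (fderiv ℝ χ x).smulRight (X x) := fun x => fderiv_fun_smul (hdχ x) (hdX x)
  have hcont : Continuous fun x => Metric.infDist x A := Metric.continuous_infDist_pt A
  refine ⟨fun x => χ x • X x, (hχ.of_le hm).smul hX, hXc.smul_left, ?_, fun x => ?_,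
    fun x hx => ?_, fun x => ?_⟩
  · refine fun x hx => ⟨closure_mono (Function.support_smul_subset_right χ X) hx, fun hxA => ?_⟩
    refine (notMem_tsupport_iff_eventuallyEq.2 ?_) hx
    have : ∀ᶠ y in 𝓝 x, Metric.infDist y A < r / 4 := by
      refine hcont.continuousAt.eventually_lt continuousAt_const ?_
      rw [Metric.infDist_zero_of_mem hxA]
      positivity
    filter_upwards [this] with y hy
    simp [hχ0 y hy]
  · rw [norm_smul, Real.norm_of_nonneg (hχ01 x).1]
    exact mul_le_of_le_one_left (norm_nonneg _) (hχ01 x).2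
  · have hxr : r ≤ Metric.infDist x A := by
      simpa [Metric.mem_thickening_iff_infDist_lt hA] using hx
    have : ∀ᶠ y in 𝓝 x, 3 * r / 4 < Metric.infDist y A :=
      continuousAt_const.eventually_lt hcont.continuousAt (by linarith)
    have heq : (fun y => χ y • X y) =ᶠ[𝓝 x] X := by
      filter_upwards [this] with y hy
      simp [hχ1 y hy.le]
    exact ⟨heq.eq_of_nhds, heq.fderiv_eq⟩
  · rw [hfd, show fderiv ℝ X x - (χ x • fderiv ℝ X x + (fderiv ℝ χ x).smulRight (X x))
      = (1 - χ x) • fderiv ℝ X x - (fderiv ℝ χ x).smulRight (X x) by module]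
    refine (norm_sub_le _ _).trans ?_
    rw [norm_smul, ContinuousLinearMap.norm_smulRight_apply, add_div]
    refine add_le_add ?_ ?_
    · have h1 : ‖1 - χ x‖ ≤ 1 := by
        rw [Real.norm_of_nonneg (by linarith [(hχ01 x).2])]
        linarith [(hχ01 x).1]
      calc ‖1 - χ x‖ * ‖fderiv ℝ X x‖ ≤ 1 * B' := by gcongr; exact hB' x
        _ ≤ B' / r := by rw [one_mul, le_div_iff₀ hr]; exact mul_le_of_le_one_right hB0' hr1
    · calc ‖fderiv ℝ χ x‖ * ‖X x‖ ≤ 4 / r * B := by gcongr; exacts [hχd x, hB x]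
        _ = 4 * B / r := by ring

end Cutoff

end HamStat

/-! ### Hölder's inequality and bounds on the tangential divergence. -/

namespace HamStat

theorem setLIntegral_le_lintegral_pow_mul_measure {X : Type*} [MeasurableSpace X] {μ : Measure X}
    {n : ℕ} (hn : 2 ≤ n) {g : X → ℝ≥0∞} (hg : AEMeasurable g μ) (U : Set X) :
    ∫⁻ x in U, g x ∂μ ≤
      (∫⁻ x in U, g x ^ n ∂μ) ^ (1 / (n : ℝ)) * μ U ^ (1 / ((n : ℝ) / ((n : ℝ) - 1))) := by
  have hn' : (2 : ℝ) ≤ n := by exact_mod_cast hn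
  have h := ENNReal.lintegral_mul_le_Lp_mul_Lq (μ.restrict U)
    (Real.HolderConjugate.conjExponent (p := n) (by linarith)) (f := g) (g := fun _ => 1)
    hg.restrict aemeasurable_const
  simpa [Real.conjExponent] using h

section Divergence

variable {n : ℕ}

/-- The ambient dimension makes the bound uniform in `P`, so nothing need be known about the
approximate tangent spaces. -/
theorem abs_divAlong_le (P : Submodule ℝ (ComplexSpace n)) (X : ComplexSpace n → ComplexSpace n)
    (x : ComplexSpace n) :
    |divAlong P X x| ≤ Module.finrank ℝ (ComplexSpace n) * ‖fderiv ℝ X x‖ := by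
  calc |divAlong P X x| ≤ ∑ i, |⟪fderiv ℝ X x (stdOrthonormalBasis ℝ P i),
        (stdOrthonormalBasis ℝ P i : ComplexSpace n)⟫_ℝ| := Finset.abs_sum_le_sum_abs _ _
    _ ≤ ∑ _i : Fin (Module.finrank ℝ P), ‖fderiv ℝ X x‖ := by
      refine Finset.sum_le_sum fun i _ => ?_
      have h1 : ‖(stdOrthonormalBasis ℝ P i : ComplexSpace n)‖ = 1 := by
        rw [← Submodule.coe_norm, (stdOrthonormalBasis ℝ P).norm_eq_one]
      refine (abs_real_inner_le_norm _ _).trans ?_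
      rw [h1, mul_one]
      simpa [h1] using (fderiv ℝ X x).le_opNorm (stdOrthonormalBasis ℝ P i : ComplexSpace n)
    _ = Module.finrank ℝ P * ‖fderiv ℝ X x‖ := by simp
    _ ≤ _ := by
      gcongr
      exact Submodule.finrank_le P

theorem divAlong_congr (P : Submodule ℝ (ComplexSpace n)) {X Y : ComplexSpace n → ComplexSpace n}
    {x : ComplexSpace n} (h : fderiv ℝ Y x = fderiv ℝ X x) : divAlong P Y x = divAlong P X x := by
  simp only [divAlong, h]

theorem abs_divAlong_sub_le (P : Submodule ℝ (ComplexSpace n))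
    {X Y : ComplexSpace n → ComplexSpace n} {x : ComplexSpace n} (hX : DifferentiableAt ℝ X x)
    (hY : DifferentiableAt ℝ Y x) :
    |divAlong P X x - divAlong P Y x| ≤
      Module.finrank ℝ (ComplexSpace n) * ‖fderiv ℝ X x - fderiv ℝ Y x‖ := by
  have h : divAlong P X x - divAlong P Y x = divAlong P (X - Y) x := by
    simp only [divAlong, fderiv_sub hX hY, sub_apply, inner_sub_left,
      Finset.sum_sub_distrib]
  rw [h, ← fderiv_sub hX hY]
  exact abs_divAlong_le P _ x

theorem norm_J (v : ComplexSpace n) : ‖J v‖ = ‖v‖ := by simp [J, norm_smul]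

theorem J_sub (v w : ComplexSpace n) : J (v - w) = J v - J w := smul_sub _ _ _

theorem continuous_J : Continuous (J (n := n)) := continuous_const_smul _

theorem norm_gradient_sub (f g : ComplexSpace n → ℝ) (x : ComplexSpace n) :
    ‖gradient f x - gradient g x‖ = ‖fderiv ℝ f x - fderiv ℝ g x‖ := by
  simp only [gradient]
  rw [← map_sub, LinearIsometryEquiv.norm_map]

end Divergence

/-! ### Removing `N` from the two integral identities. -/

section Removable

variable {n : ℕ} {Ω N : Set (ComplexSpace n)} {μ : Measure (ComplexSpace n)}
  {H : ComplexSpace n → ComplexSpace n} {r : ℕ → ℝ}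

theorem eventually_notMem_thickening {E : Type*} [PseudoMetricSpace E] {N : Set E}
    (hN : IsClosed N) (hNne : N.Nonempty) (hr : Tendsto r atTop (𝓝 0)) {x : E} (hx : x ∉ N) :
    ∀ᶠ i in atTop, x ∉ Metric.thickening (r i) N := by
  have : 0 < Metric.infDist x N := (hN.notMem_iff_infDist_pos hNne).1 hx
  filter_upwards [hr.eventually_lt_const this] with i hi
  simpa [Metric.mem_thickening_iff_infDist_lt hNne] using hi.le

/-- The cut-off function is admissible in `Ω \ N`, and its gradient differs from that of `f` by at
most `K / r`, only in the `r`-thickening of `N`. -/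
theorem integral_inner_gradient_eq_zero_of_removable (hNne : N.Nonempty)
    (hH : Integrable H μ)
    (hrpos : ∀ i, 0 < r i) (hr0 : Tendsto r atTop (𝓝 0))
    (hHU : Tendsto (fun i => (r i)⁻¹ * ∫ x in Metric.thickening (r i) N, ‖H x‖ ∂μ) atTop (𝓝 0))
    (hstat : ∀ f : ComplexSpace n → ℝ,
      ContDiff ℝ ∞ f → HasCompactSupport f → tsupport f ⊆ Ω \ N →
        ∫ x, ⟪J (gradient f x), H x⟫_ℝ ∂μ = 0)
    {f : ComplexSpace n → ℝ} (hf : ContDiff ℝ ∞ f) (hfc : HasCompactSupport f)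
    (hfΩ : tsupport f ⊆ Ω) :
    ∫ x, ⟪J (gradient f x), H x⟫_ℝ ∂μ = 0 := by
  obtain ⟨K, hK, hcut⟩ := exists_cutoff_map hNne (by simp) le_rfl hf hfc
  have hint : ∀ g : ComplexSpace n → ℝ, ContDiff ℝ ∞ g → HasCompactSupport g →
      Integrable (fun x => ⟪J (gradient g x), H x⟫_ℝ) μ := fun g hg hgc => by
    obtain ⟨B, hB⟩ := (hgc.fderiv (𝕜 := ℝ)).exists_bound_of_continuous
      (hg.continuous_fderiv (by simp))
    have hcont : Continuous fun x => J (gradient g x) := continuous_J.comp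
      ((LinearIsometryEquiv.continuous _).comp (hg.continuous_fderiv (by simp)))
    refine (hH.norm.const_mul B).mono' (hcont.aestronglyMeasurable.inner hH.1)
      (Eventually.of_forall fun x => ?_)
    refine (norm_inner_le_norm _ _).trans ?_
    rw [norm_J, gradient, LinearIsometryEquiv.norm_map]
    gcongr
    exact hB x
  have hle : ∀ᶠ i in atTop, |∫ x, ⟪J (gradient f x), H x⟫_ℝ ∂μ| ≤
      K * ((r i)⁻¹ * ∫ x in Metric.thickening (r i) N, ‖H x‖ ∂μ) := by
    filter_upwards [hr0.eventually_le_const one_pos] with i hi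
    obtain ⟨g, hg, hgc, hgs, -, hgeq, hgd⟩ := hcut (r i) (hrpos i) hi
    have hgz := hstat g hg hgc (hgs.trans (sdiff_subset_sdiff_left hfΩ))
    calc |∫ x, ⟪J (gradient f x), H x⟫_ℝ ∂μ|
        = |∫ x, (⟪J (gradient f x), H x⟫_ℝ - ⟪J (gradient g x), H x⟫_ℝ) ∂μ| := by
          rw [integral_sub (hint f hf hfc) (hint g hg hgc), hgz, sub_zero]
      _ = |∫ x, ⟪J (gradient f x - gradient g x), H x⟫_ℝ ∂μ| := by
          simp only [J_sub, inner_sub_left]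
      _ = |∫ x in Metric.thickening (r i) N, ⟪J (gradient f x - gradient g x), H x⟫_ℝ ∂μ| := by
          rw [setIntegral_eq_integral_of_forall_compl_eq_zero]
          intro x hx
          have h0 : gradient f x - gradient g x = 0 := by
            rw [← norm_eq_zero, norm_gradient_sub, (hgeq x hx).2, sub_self, norm_zero]
          rw [h0]
          simp [J]
      _ ≤ ∫ x in Metric.thickening (r i) N, K / r i * ‖H x‖ ∂μ := by
          rw [← Real.norm_eq_abs]
          refine norm_integral_le_of_norm_le (hH.norm.const_mul _).integrableOn
            (Eventually.of_forall fun x => ?_)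
          refine (norm_inner_le_norm _ _).trans ?_
          rw [norm_J, norm_gradient_sub]
          gcongr
          exact hgd x
      _ = _ := by rw [integral_const_mul]; ring
  have hlim := hHU.const_mul K
  rw [mul_zero] at hlim
  exact abs_eq_zero.1 (le_antisymm (ge_of_tendsto hlim hle) (abs_nonneg _))

/-- Cut-off fields satisfy the identity. Their divergences converge in integral because mass over
`r` tends to `0`; the curvature terms converge by domination, since `N` is null. -/
theorem hasGeneralizedMeanCurvature_of_removable [IsFiniteMeasure μ] (hNc : IsCompact N)
    (hNne : N.Nonempty) (hμN : μ N = 0) (hH : Integrable H μ)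
    (hrpos : ∀ i, 0 < r i) (hr0 : Tendsto r atTop (𝓝 0))
    (hU : Tendsto (fun i => (r i)⁻¹ * μ.real (Metric.thickening (r i) N)) atTop (𝓝 0))
    (hcurv : HasGeneralizedMeanCurvature n (Ω \ N) μ H) :
    HasGeneralizedMeanCurvature n Ω μ H := by
  refine ⟨hH.locallyIntegrable.locallyIntegrableOn Ω, fun X hX hXc hXΩ => ?_⟩
  obtain ⟨K, hK, hcut⟩ := exists_cutoff_map hNne le_rfl (by simp) hX hXc
  obtain ⟨B, hB⟩ := hXc.exists_bound_of_continuous hX.continuous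
  obtain ⟨B', hB'⟩ := (hXc.fderiv (𝕜 := ℝ)).exists_bound_of_continuous
    (hX.continuous_fderiv one_ne_zero)
  -- The cutoffs are available only at scales `r ≤ 1`, hence the shift by `i₀`.
  obtain ⟨i₀, hi₀⟩ := eventually_atTop.1 (hr0.eventually_le_const one_pos)
  choose Y hY hYc hYs hYle hYeq hYd using fun i : ℕ =>
    hcut (r (i + i₀)) (hrpos _) (hi₀ _ (Nat.le_add_left _ _))
  replace hr0 : Tendsto (fun i => r (i + i₀)) atTop (𝓝 0) := (tendsto_add_atTop_iff_nat i₀).2 hr0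
  replace hU := (tendsto_add_atTop_iff_nat i₀).2 hU
  have hvar := fun i => hcurv.firstVariation (Y i) (hY i) (hYc i)
    ((hYs i).trans (sdiff_subset_sdiff_left hXΩ))
  have hae : ∀ᵐ x ∂μ, ∀ᶠ i in atTop, x ∉ Metric.thickening (r (i + i₀)) N := by
    filter_upwards [measure_eq_zero_iff_ae_notMem.1 hμN] with x hx
    exact eventually_notMem_thickening hNc.isClosed hNne hr0 hx
  set c : ℝ := (Module.finrank ℝ (ComplexSpace n) : ℝ)
  have hc : 0 ≤ c := Nat.cast_nonneg _
  -- The tangent spaces are chosen, so measurability is inherited: the integrand is an a.e.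
  -- eventually constant limit of the divergences of `Y i`, integrable by hypothesis.
  have hmeas : AEStronglyMeasurable (fun x => divAlong (approxTangent n μ x) X x) μ := by
    refine aestronglyMeasurable_of_tendsto_ae atTop (fun i => (hvar i).1.1) ?_
    filter_upwards [hae] with x hx
    refine tendsto_const_nhds.congr' ?_
    filter_upwards [hx] with i hi
    exact (divAlong_congr _ (hYeq i x hi).2).symm
  have hint : Integrable (fun x => divAlong (approxTangent n μ x) X x) μ := by
    refine (integrable_const (c * B')).mono' hmeas (Eventually.of_forall fun x => ?_)
    refine (abs_divAlong_le _ X x).trans ?_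
    gcongr
    exact hB' x
  refine ⟨hint, ?_⟩
  have hlim₁ : Tendsto (fun i => ∫ x, divAlong (approxTangent n μ x) (Y i) x ∂μ) atTop
      (𝓝 (∫ x, divAlong (approxTangent n μ x) X x ∂μ)) := by
    refine tendsto_iff_dist_tendsto_zero.2 (squeeze_zero (fun _ => dist_nonneg) (fun i => ?_)
      (by simpa using hU.const_mul (c * K)))
    rw [dist_comm, Real.dist_eq, ← integral_sub hint (hvar i).1,
      ← setIntegral_eq_integral_of_forall_compl_eq_zero (s := Metric.thickening (r (i + i₀)) N)
      fun x hx => by rw [divAlong_congr _ (hYeq i x hx).2, sub_self]]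
    calc _ ≤ c * (K / r (i + i₀)) * μ.real (Metric.thickening (r (i + i₀)) N) := by
          rw [← Real.norm_eq_abs]
          refine norm_setIntegral_le_of_norm_le_const (measure_lt_top _ _) fun x _ => ?_
          refine (abs_divAlong_sub_le _ (hX.differentiable one_ne_zero x)
            ((hY i).differentiable one_ne_zero x)).trans ?_
          gcongr
          exact hYd i x
      _ = _ := by ring
  have hlim₂ : Tendsto (fun i => ∫ x, ⟪H x, Y i x⟫_ℝ ∂μ) atTop (𝓝 (∫ x, ⟪H x, X x⟫_ℝ ∂μ)) := by
    refine tendsto_integral_of_dominated_convergence (fun x => ‖H x‖ * B)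
      (fun i => hH.1.inner (hY i).continuous.aestronglyMeasurable) (hH.norm.mul_const B)
      (fun i => Eventually.of_forall fun x => ?_) ?_
    · refine (norm_inner_le_norm _ _).trans ?_
      gcongr
      exact (hYle i x).trans (hB x)
    · filter_upwards [hae] with x hx
      refine tendsto_const_nhds.congr' ?_
      filter_upwards [hx] with i hi
      rw [(hYeq i x hi).1]
  refine tendsto_nhds_unique hlim₁ ?_
  simp only [fun i => (hvar i).2]
  exact hlim₂.neg

end Removable

end HamStat

namespace HamStat

/-! ### Invariance under null sets. -/

section Weight

variable {n : ℕ} {k : ℕ} {S T : Set (ComplexSpace n)} {β : ComplexSpace n → ℕ}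

theorem weight_congr (h : S =ᵐ[(μH[(k : ℝ)] : Measure (ComplexSpace n))] T) :
    weight k S β = weight k T β := by
  rw [weight, weight, Measure.restrict_congr_set h]

theorem isFiniteMeasure_weight
    (hβ : IntegrableOn (fun x => (β x : ℝ)) S (μH[(k : ℝ)] : Measure (ComplexSpace n))) :
    IsFiniteMeasure (weight k S β) := by
  refine isFiniteMeasure_withDensity (ne_of_lt ?_)
  simpa [HasFiniteIntegral] using hβ.2

theorem weight_compl_eq_zero
    (hS : NullMeasurableSet S (μH[(k : ℝ)] : Measure (ComplexSpace n))) :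
    weight k S β Sᶜ = 0 :=
  withDensity_absolutelyContinuous _ _ (mem_ae_iff.1 (ae_restrict_mem₀ hS))

/-- Integrability of `β` on all of `S` is what gives local integrability at points of `V` outside
`U`. -/
theorem IsIntegralVarifold.of_ae_eq {U V : Set (ComplexSpace n)} (h : IsIntegralVarifold k U S β)
    (hTV : T ⊆ V) (hTS : T =ᵐ[(μH[(k : ℝ)] : Measure (ComplexSpace n))] S)
    (hβ : IntegrableOn (fun x => (β x : ℝ)) S (μH[(k : ℝ)] : Measure (ComplexSpace n))) :
    IsIntegralVarifold k V T β := by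
  obtain ⟨F, hF, hSF⟩ := h.rectifiable
  refine ⟨hTV, h.measurable.congr hTS.symm, ⟨F, hF, ?_⟩, ?_⟩
  · rw [← hSF]
    exact measure_congr (hTS.diff (ae_eq_refl _))
  · rw [Measure.restrict_congr_set hTS]
    exact hβ.integrable.locallyIntegrable.locallyIntegrableOn V

end Weight

/-! ### Decay of the cutoff errors along the scales `ε i / 2`. -/

section Scales

variable {n : ℕ} {N : Set (ComplexSpace n)} {μ : Measure (ComplexSpace n)}
  {H : ComplexSpace n → ComplexSpace n} {ε : ℕ → ℝ}

theorem tendsto_inv_mul_measureReal_thickening [IsFiniteMeasure μ] {K p : ℝ} (hp : 1 < p)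
    (hK : 0 ≤ K) (hεpos : ∀ i, 0 < ε i) (hεlim : Tendsto ε atTop (𝓝 0))
    (hU : ∀ᶠ i in atTop, μ (Metric.thickening (ε i / 2) N) ≤ ENNReal.ofReal (K * ε i ^ p)) :
    Tendsto (fun i => (ε i / 2)⁻¹ * μ.real (Metric.thickening (ε i / 2) N)) atTop (𝓝 0) := by
  have hlim : Tendsto (fun i => 2 * K * ε i ^ (p - 1)) atTop (𝓝 0) := by
    have := (hεlim.rpow_const (p := p - 1) (Or.inr (by linarith))).const_mul (2 * K)
    rwa [Real.zero_rpow (by linarith), mul_zero] at this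
  refine squeeze_zero' (Eventually.of_forall fun i => ?_) ?_ hlim
  · have := hεpos i
    positivity
  · filter_upwards [hU] with i hi
    have h0 := hεpos i
    have h1 : μ.real (Metric.thickening (ε i / 2) N) ≤ K * ε i ^ p :=
      ENNReal.toReal_le_of_le_ofReal (by positivity) hi
    calc (ε i / 2)⁻¹ * μ.real (Metric.thickening (ε i / 2) N) ≤ (ε i / 2)⁻¹ * (K * ε i ^ p) := by
          gcongr
      _ = 2 * K * ε i ^ (p - 1) := by
          rw [Real.rpow_sub_one h0.ne']
          field_simp

/-- Hölder exactly cancels the factor `(ε i)⁻¹`; the decay comes solely from the `L^n` integral of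
`H` over sets of vanishing mass. -/
theorem tendsto_inv_mul_setIntegral_norm_thickening [IsFiniteMeasure μ] (hn : 2 ≤ n) {K : ℝ}
    (hK : 0 ≤ K) (hεpos : ∀ i, 0 < ε i) (hεlim : Tendsto ε atTop (𝓝 0))
    (hH : AEStronglyMeasurable H μ) (hHn : ∫⁻ x, ‖H x‖ₑ ^ n ∂μ ≠ ⊤)
    (hU : ∀ᶠ i in atTop, μ (Metric.thickening (ε i / 2) N) ≤
      ENNReal.ofReal (K * ε i ^ ((n : ℝ) / ((n : ℝ) - 1)))) :
    Tendsto (fun i => (ε i / 2)⁻¹ * ∫ x in Metric.thickening (ε i / 2) N, ‖H x‖ ∂μ)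
      atTop (𝓝 0) := by
  have hn' : (2 : ℝ) ≤ n := by exact_mod_cast hn
  set p : ℝ := (n : ℝ) / ((n : ℝ) - 1)
  have hp : 0 < p := div_pos (by linarith) (by linarith)
  have hμU : Tendsto (fun i => μ (Metric.thickening (ε i / 2) N)) atTop (𝓝 0) := by
    have hlim : Tendsto (fun i => ENNReal.ofReal (K * ε i ^ p)) atTop (𝓝 0) := by
      have := (hεlim.rpow_const (p := p) (Or.inr hp.le)).const_mul K
      rw [Real.zero_rpow hp.ne', mul_zero] at this
      simpa using ENNReal.tendsto_ofReal this
    exact tendsto_of_tendsto_of_tendsto_of_le_of_le' tendsto_const_nhds hlim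
      (Eventually.of_forall fun _ => zero_le) hU
  have hI : Tendsto (fun i => ∫⁻ x in Metric.thickening (ε i / 2) N, ‖H x‖ₑ ^ n ∂μ)
      atTop (𝓝 0) := tendsto_setLIntegral_zero hHn hμU
  have hIne : ∀ i, ∫⁻ x in Metric.thickening (ε i / 2) N, ‖H x‖ₑ ^ n ∂μ ≠ ⊤ := fun i =>
    ne_top_of_le_ne_top hHn (setLIntegral_le_lintegral _ _)
  have hlim : Tendsto (fun i => 2 * K ^ (1 / p) *
      (∫⁻ x in Metric.thickening (ε i / 2) N, ‖H x‖ₑ ^ n ∂μ).toReal ^ (1 / (n : ℝ)))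
      atTop (𝓝 0) := by
    have h1 := (ENNReal.tendsto_toReal ENNReal.zero_ne_top).comp hI
    have h2 := (h1.rpow_const (p := 1 / (n : ℝ)) (Or.inr (by positivity))).const_mul
      (2 * K ^ (1 / p))
    rwa [ENNReal.toReal_zero, Real.zero_rpow (by positivity), mul_zero] at h2
  refine squeeze_zero' (Eventually.of_forall fun i => ?_) ?_ hlim
  · have := hεpos i
    positivity
  · filter_upwards [hU] with i hi
    have h0 := hεpos i
    have h1 : μ.real (Metric.thickening (ε i / 2) N) ≤ K * ε i ^ p :=
      ENNReal.toReal_le_of_le_ofReal (by positivity) hi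
    have h2 : ∫ x in Metric.thickening (ε i / 2) N, ‖H x‖ ∂μ ≤
        (∫⁻ x in Metric.thickening (ε i / 2) N, ‖H x‖ₑ ^ n ∂μ).toReal ^ (1 / (n : ℝ)) *
          μ.real (Metric.thickening (ε i / 2) N) ^ (1 / p) := by
      rw [integral_norm_eq_lintegral_enorm hH.restrict, measureReal_def, ENNReal.toReal_rpow,
        ENNReal.toReal_rpow, ← ENNReal.toReal_mul]
      refine ENNReal.toReal_mono (ENNReal.mul_ne_top
        (ENNReal.rpow_ne_top_of_nonneg (by positivity) (hIne i))
        (ENNReal.rpow_ne_top_of_nonneg (by positivity) (measure_ne_top _ _))) ?_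
      exact setLIntegral_le_lintegral_pow_mul_measure hn hH.enorm _
    have h3 : μ.real (Metric.thickening (ε i / 2) N) ^ (1 / p) ≤ K ^ (1 / p) * ε i := by
      calc _ ≤ (K * ε i ^ p) ^ (1 / p) := by gcongr
        _ = K ^ (1 / p) * ε i := by
          rw [Real.mul_rpow hK (by positivity), ← Real.rpow_mul h0.le, mul_one_div_cancel hp.ne',
            Real.rpow_one]
    calc _ ≤ (ε i / 2)⁻¹ * ((∫⁻ x in Metric.thickening (ε i / 2) N,
            ‖H x‖ₑ ^ n ∂μ).toReal ^ (1 / (n : ℝ)) * (K ^ (1 / p) * ε i)) := by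
          gcongr
          exact h2.trans (by gcongr)
      _ = _ := by field_simp

end Scales

/-- The dimensions `k a` cancel piece by piece, leaving the common exponent `p`, so the constants
simply add. -/
theorem exists_measure_thickening_iUnion_le {n : ℕ} {a₀ : ℕ} {Nα : Fin a₀ → Set (ComplexSpace n)}
    {k : Fin a₀ → ℝ} (hcompact : ∀ a, IsCompact (Nα a)) (hfinite : ∀ a, μH[k a] (Nα a) < ⊤)
    (hnoncollapsing : ∀ a, LocallyNoncollapsing (k a) (Nα a)) {μ : Measure (ComplexSpace n)}
    {ε : ℕ → ℝ} (hεpos : ∀ i, 0 < ε i) (hεlim : Tendsto ε atTop (𝓝 0)) {C p : ℝ} (hC : 0 ≤ C)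
    (hball : ∀ i a, ∀ y ∈ Nα a, μ (Metric.ball y (ε i)) ≤ ENNReal.ofReal (C * ε i ^ (k a + p))) :
    ∃ K : ℝ, 0 ≤ K ∧ ∀ᶠ i in atTop,
      μ (Metric.thickening (ε i / 2) (⋃ a, Nα a)) ≤ ENNReal.ofReal (K * ε i ^ p) := by
  have key : ∀ a, ∃ K : ℝ, 0 ≤ K ∧ ∀ᶠ i in atTop,
      μ (Metric.thickening (ε i / 2) (Nα a)) ≤ ENNReal.ofReal (K * ε i ^ p) := fun a => by
    obtain ⟨δ, hδ, c, hc, hnc⟩ := hnoncollapsing a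
    obtain ⟨K, hK, h⟩ := exists_measure_thickening_le (hcompact a) μH[k a] μ (hfinite a)
      (k := k a) (p := p) hc hC
    refine ⟨K, hK, ?_⟩
    filter_upwards [hεlim.eventually_lt_const hδ] with i hi
    have h0 := hεpos i
    exact h (ε i) h0 (hnc (ε i / 4) ⟨by positivity, by linarith⟩) (hball i a)
  choose K hK hKle using key
  refine ⟨∑ a, K a, Finset.sum_nonneg fun a _ => hK a, ?_⟩
  filter_upwards [eventually_all.2 hKle] with i hi
  have h0 := hεpos i
  rw [Metric.thickening_iUnion, Finset.sum_mul,
    ENNReal.ofReal_sum_of_nonneg fun a _ => mul_nonneg (hK a) (by positivity)]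
  exact (measure_iUnion_fintype_le _ _).trans (Finset.sum_le_sum fun a _ => hi a)

end HamStat

/-! ### The removability theorem. -/

theorem mainTheorem2 {n : ℕ} (Ω : Set (ComplexSpace n)) (hΩ : IsOpen Ω)
    -- the small set `N`
    {a₀ : ℕ} (Nα : Fin a₀ → Set (ComplexSpace n)) (k : Fin a₀ → ℝ)
    (N : Set (ComplexSpace n)) (hN : N = ⋃ a, Nα a)
    (hcompact : ∀ a, IsCompact (Nα a)) (hNΩ : ∀ a, Nα a ⊆ Ω)
    (hk0 : ∀ a, 0 ≤ k a) (hk : ∀ a, k a ≤ (n : ℝ) - 2)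
    (hfinite : ∀ a, μH[k a] (Nα a) < ⊤)
    (hnoncollapsing : ∀ a, HamStat.LocallyNoncollapsing (k a) (Nα a))
    -- the immersed Lagrangian submanifold `L` of `Ω \ N`
    {M : Type*} [TopologicalSpace M] [T2Space M] [SecondCountableTopology M]
    [ChartedSpace (EuclideanSpace ℝ (Fin n)) M] [IsManifold (𝓡 n) ∞ M]
    (F : M → ComplexSpace n) (hF : HamStat.IsLagrangianImmersion F)
    (L : Set (ComplexSpace n)) (hLF : L = range F) (hLΩ : L ⊆ Ω \ N)
    (hclosure : (closure L ∩ Ω) \ L ⊆ N)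
    -- its multiplicity `β` and its generalized mean curvature `H`
    (β : ComplexSpace n → ℕ)
    (hβ : IntegrableOn (fun x => (β x : ℝ)) L μH[(n : ℝ)])
    (H : ComplexSpace n → ComplexSpace n)
    (hstationary : HamStat.IsHamiltonianStationary n (Ω \ N) L β H)
    -- assumption (i)
    (C₁ : ℝ)
    (hi : ∫⁻ x in Ω, ‖H x‖ₑ ^ n ∂(HamStat.weight n L β) < ENNReal.ofReal C₁)
    -- assumption (ii)
    (C₄ : ℝ) (hC₄ : 0 < C₄)
    (hii : ∀ V : Set (ComplexSpace n), IsOpen V →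
      HamStat.weight n L β (L ∩ V) ≤ ENNReal.ofReal C₄ * μH[(n : ℝ)] (L ∩ V))
    -- assumption (iii)
    (C₂ : ℝ) (ε : ℕ → ℝ) (hεpos : ∀ i, 0 < ε i) (hεanti : Antitone ε)
    (hεlim : Tendsto ε atTop (𝓝 0))
    (hiii : ∀ i a, ∀ y ∈ Nα a, μH[(n : ℝ)] (L ∩ Metric.ball y (ε i)) <
      ENNReal.ofReal (C₂ * ε i ^ (k a + (n : ℝ) / ((n : ℝ) - 1)))) :
    ∃ ℋ : ComplexSpace n → ComplexSpace n,
      HamStat.IsHamiltonianStationary n Ω (closure L ∩ Ω) β ℋ := by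
  have hLcl : L ⊆ closure L ∩ Ω := fun x hx => ⟨subset_closure hx, (hLΩ hx).1⟩
  -- A nonempty `N` is needed for the distance cutoffs, and it forces `n ≥ 2`.
  rcases N.eq_empty_or_nonempty with hNe | hNne
  · have hL : closure L ∩ Ω = L := by
      refine Subset.antisymm (sdiff_eq_empty.1 (subset_empty_iff.1 ?_)) hLcl
      rwa [hNe] at hclosure
    rw [hNe, sdiff_empty] at hstationary
    exact ⟨H, hL.symm ▸ hstationary⟩
  have hn : 2 ≤ n := by
    obtain ⟨x, hx⟩ := hNne
    rw [hN] at hx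
    obtain ⟨a, -⟩ := mem_iUnion.1 hx
    have : (2 : ℝ) ≤ n := by linarith [hk0 a, hk a]
    exact_mod_cast this
  have hn' : (2 : ℝ) ≤ n := by exact_mod_cast hn
  have hNc : IsCompact N := hN ▸ isCompact_iUnion hcompact
  -- Finite `ℋ^k` mass with `k < n` forces `ℋ^n` to vanish.
  have hHN : (μH[(n : ℝ)] : Measure (ComplexSpace n)) N = 0 := by
    rw [hN]
    refine measure_iUnion_null fun a => ?_
    exact (Measure.hausdorffMeasure_zero_or_top (by linarith [hk a]) (Nα a)).resolve_right
      (hfinite a).ne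
  have hae : (closure L ∩ Ω : Set (ComplexSpace n)) =ᵐ[(μH[(n : ℝ)] : Measure (ComplexSpace n))] L := by
    refine (ae_eq_set.2 ⟨measure_mono_null hclosure hHN, ?_⟩)
    rw [sdiff_eq_empty.2 hLcl, measure_empty]
  have hwt := HamStat.weight_congr (β := β) hae
  have hvar := hstationary.varifold
  have hcurv := hstationary.meanCurvature
  have hstat := hstationary.stationary
  have hLc := HamStat.weight_compl_eq_zero (β := β) hvar.measurable
  have := HamStat.isFiniteMeasure_weight hβ
  set μ := HamStat.weight n L β
  have hμL : ∀ s, L ⊆ s → μ.restrict s = μ := fun s hs =>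
    Measure.restrict_eq_self_of_ae_mem (measure_mono_null (compl_subset_compl.2 hs) hLc)
  have hHm : AEStronglyMeasurable H μ := by
    have h := hcurv.locallyIntegrable.aestronglyMeasurable
    rwa [hμL _ hLΩ] at h
  have hHn : ∫⁻ x, ‖H x‖ₑ ^ n ∂μ ≠ ⊤ := by
    rw [hμL Ω (hLΩ.trans sdiff_subset)] at hi
    exact hi.ne_top
  -- Hölder on the whole space: `H` is in `L^n` and `μ` is finite.
  have hHint : Integrable H μ := by
    refine ⟨hHm, lt_of_le_of_lt ?_ (ENNReal.mul_lt_top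
      (ENNReal.rpow_lt_top_of_nonneg (y := 1 / (n : ℝ)) (by positivity) hHn)
      (ENNReal.rpow_lt_top_of_nonneg (y := 1 / ((n : ℝ) / ((n : ℝ) - 1)))
        (one_div_nonneg.2 (div_nonneg (by linarith) (by linarith))) (measure_ne_top μ univ)))⟩
    simpa using HamStat.setLIntegral_le_lintegral_pow_mul_measure hn hHm.enorm univ
  have hball : ∀ i a, ∀ y ∈ Nα a, μ (Metric.ball y (ε i)) ≤
      ENNReal.ofReal (C₄ * |C₂| * ε i ^ (k a + (n : ℝ) / ((n : ℝ) - 1))) := fun i a y hy => by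
    have h0 := hεpos i
    calc μ (Metric.ball y (ε i)) = μ (L ∩ Metric.ball y (ε i)) :=
          (measure_inter_conull' (measure_mono_null (fun x hx => hx.2) hLc)).symm.trans
            (by rw [inter_comm])
      _ ≤ ENNReal.ofReal C₄ * μH[(n : ℝ)] (L ∩ Metric.ball y (ε i)) := hii _ Metric.isOpen_ball
      _ ≤ ENNReal.ofReal C₄ *
          ENNReal.ofReal (C₂ * ε i ^ (k a + (n : ℝ) / ((n : ℝ) - 1))) := by
        gcongr
        exact (hiii i a y hy).le
      _ = ENNReal.ofReal (C₄ * (C₂ * ε i ^ (k a + (n : ℝ) / ((n : ℝ) - 1)))) :=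
        (ENNReal.ofReal_mul hC₄.le).symm
      _ ≤ _ := by
        refine ENNReal.ofReal_le_ofReal ?_
        rw [mul_assoc]
        gcongr
        exact le_abs_self _
  obtain ⟨K, hK, hU⟩ := HamStat.exists_measure_thickening_iUnion_le hcompact hfinite hnoncollapsing
    hεpos hεlim (by positivity) hball
  rw [← hN] at hU
  have hrpos : ∀ i, 0 < ε i / 2 := fun i => half_pos (hεpos i)
  have hrlim : Tendsto (fun i => ε i / 2) atTop (𝓝 0) := by simpa using hεlim.div_const 2
  have hp : 1 < (n : ℝ) / ((n : ℝ) - 1) := by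
    rw [one_lt_div (by linarith)]
    linarith
  refine ⟨H, hvar.of_ae_eq inter_subset_right hae hβ, ?_, fun f hf hfc hfΩ => ?_⟩
  · rw [hwt]
    exact HamStat.hasGeneralizedMeanCurvature_of_removable hNc hNne
      (measure_mono_null (fun x hx hxL => (hLΩ hxL).2 hx) hLc) hHint hrpos hrlim
      (HamStat.tendsto_inv_mul_measureReal_thickening hp hK hεpos hεlim hU) hcurv
  · rw [hwt]
    exact HamStat.integral_inner_gradient_eq_zero_of_removable hNne hHint hrpos hrlim
      (HamStat.tendsto_inv_mul_setIntegral_norm_thickening hn hK hεpos hεlim hHm hHn hU)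
      hstat hf hfc hfΩ
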